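/- Let $p$ be a prime, $n\ge 1$, $d\ge 1$ and $t\ge 0$ integers with $\gcd(d,p^n-1)=p^t+1$. Let $G:\mathbb F_{p^n}\to\mathbb F_{p^n}$ be a function whose restriction to $C_d=\{x^d : x\in\mathbb F_{p^n}\}$ is injective, and assume that $F(x)=G(x^d)$ satisfies $F(0)=0$ and is quadratic, i.e. in the unique polynomial of degree at most $p^n-1$ representing $F$, the maximal sum of base-$p$ digits of an exponent with nonzero coefficient is $2$. Put $D=\{F(x):x\in\mathbb F_{p^n}\}\setminus\{0\}$, a subset of the additive group of $\mathbb F_{p^n}$. Terminology: a $k$-subset $D$ of a finite abelian group $A$ of order $v$ is a $(v,k,\lambda)$ difference set if each nonzero $g\in A$ is of the form $g=x-y$ with $x,y\in D$, $x\ne y$, in exactly $\lambda$ ways; a $k$-subset $D$ of $A$ with $0\notin D$ is a $(v,k,\lambda,\mu)$ partial difference set if the number of such representations is $\lambda$ for every $g\in D$ and $\mu$ for every nonzero $g\notin D$; it is regular if $D=-D$. For $D=-D\not\ni 0$, the Cayley graph generated by $D$ has vertex set $A$, with $g,h$ adjacent if and only if $g-h\in D$. A $(v,k,\lambda,\mu)$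 strongly regular graph is a graph with $v$ vertices, each of degree $k$, in which two distinct vertices have $\lambda$ common neighbours if they are adjacent and $\mu$ if they are not; it is of negative Latin square type if its parameters are $(s^2, r(s+1), -s+r^2+3r, r^2+r)$ for some nonnegative integers $s,r$. (i) If $t=0$ and $p$ is odd, then $D$ is a $\left(p^n,\frac{p^n-1}{2},\frac{p^n-3}{4}\right)$ difference set when $p^n\equiv 3\pmod 4$, and a $\left(p^n,\frac{p^n-1}{2},\frac{p^n-5}{4},\frac{p^n-1}{4}\right)$ partial difference set when $p^n\equiv 1\pmod 4$. (ii) If $t>0$ and $2t\mid n$, write $n=2kt$ and $\epsilon=(-1)^k$. Then $D$ is a regular partial difference set with parameters $$\left(p^n,\ \frac{p^n-1}{p^t+1},\ \frac{p^n-3p^t-2-\epsilon p^{n/2+2t}+\epsilon p^{n/2+t}}{(p^t+1)^2},\ \frac{p^n-\epsilon p^{n/2}+\epsilon p^{n/2+t}-p^t}{(p^t+1)^2}\right);$$ hence the Cayley graph generated by $D$ in $(\mathbb F_{p^n},+)$ is a strongly regular graph with the same parameters, and when $k$ is even it is of negative Latin square type. -/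

import Mathlib

/-- The unique polynomial of degree less than `#K` that represents the function `F : K → K`
on the finite field `K`. -/
noncomputable def reducedPolynomial {K : Type*} [Field K] [Fintype K] [DecidableEq K]
    (F : K → K) : Polynomial K :=
  Lagrange.interpolate Finset.univ id F

theorem reducedPolynomial_eval {K : Type*} [Field K] [Fintype K] [DecidableEq K]
    (F : K → K) (x : K) : (reducedPolynomial F).eval x = F x :=
  Lagrange.eval_interpolate_at_node (v := id) F (Set.injOn_id _) (Finset.mem_univ x)

theorem reducedPolynomial_degree_lt {K : Type*} [Field K] [Fintype K] [DecidableEq K]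
    (F : K → K) : (reducedPolynomial F).degree < (Fintype.card K : WithBot ℕ) :=
  Lagrange.degree_interpolate_lt (v := id) F (Set.injOn_id _)

/-- The `p`-weight of `i`: the sum of its base-`p` digits. -/
def pWeight (p i : ℕ) : ℕ := (Nat.digits p i).sum

/-- The algebraic degree of a function `F : K → K` on a finite field of characteristic `p`: the
maximal `p`-weight of an exponent that occurs in the reduced polynomial of `F`. -/
noncomputable def algebraicDegree (p : ℕ) {K : Type*} [Field K] [Fintype K] [DecidableEq K]
    (F : K → K) : ℕ :=
  (reducedPolynomial F).support.sup (pWeight p)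

/-- `F` is quadratic: its algebraic degree is two. -/
def IsQuadratic (p : ℕ) {K : Type*} [Field K] [Fintype K] [DecidableEq K] (F : K → K) : Prop :=
  algebraicDegree p F = 2

/-- The number of representations `g = x - y` with `x, y ∈ D` and `x ≠ y`. -/
def diffCount {A : Type*} [AddGroup A] [DecidableEq A] (D : Finset A) (g : A) : ℕ :=
  ((D ×ˢ D).filter (fun z => z.1 ≠ z.2 ∧ z.1 - z.2 = g)).card

/-- `D` is a `(v, k, l)` difference set in the additive group `A`. -/
structure IsDifferenceSet {A : Type*} [AddGroup A] [Fintype A] [DecidableEq A]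
    (D : Finset A) (v k l : ℕ) : Prop where
  card_group : Fintype.card A = v
  card_eq : D.card = k
  diffCount_eq : ∀ g : A, g ≠ 0 → diffCount D g = l

/-- `D` is a `(v, k, l, m)` partial difference set in the additive group `A`. -/
structure IsPartialDifferenceSet {A : Type*} [AddGroup A] [Fintype A] [DecidableEq A]
    (D : Finset A) (v k l m : ℕ) : Prop where
  card_group : Fintype.card A = v
  card_eq : D.card = k
  zero_notMem : (0 : A) ∉ D
  diffCount_of_mem : ∀ g ∈ D, diffCount D g = l
  diffCount_of_notMem : ∀ g : A, g ∉ D → g ≠ 0 → diffCount D g = m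

/-- A regular partial difference set: one that is closed under negation. -/
structure IsRegularPartialDifferenceSet {A : Type*} [AddGroup A] [Fintype A] [DecidableEq A]
    (D : Finset A) (v k l m : ℕ) : Prop extends IsPartialDifferenceSet D v k l m where
  neg_mem : ∀ g ∈ D, -g ∈ D

/-- The Cayley graph generated by `D`; when `0 ∉ D` and `D = -D` (the case of interest), two
vertices `g`, `h` are adjacent if and only if `g - h ∈ D`. -/
abbrev cayleyGraph {A : Type*} [AddGroup A] (D : Finset A) : SimpleGraph A :=
  SimpleGraph.circulantGraph (D : Set A)

theorem cayleyGraph_adj {A : Type*} [AddGroup A] (D : Finset A) (h0 : (0 : A) ∉ D)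
    (hneg : ∀ g ∈ D, -g ∈ D) (g h : A) : (cayleyGraph D).Adj g h ↔ g - h ∈ D := by
  simp only [SimpleGraph.circulantGraph_adj, Finset.mem_coe]
  constructor
  · rintro ⟨-, h1 | h1⟩
    · exact h1
    · simpa using hneg _ h1
  · intro h1
    refine ⟨?_, Or.inl h1⟩
    rintro rfl
    exact h0 (by simpa using h1)

/-- A strongly regular graph of negative Latin square type: its parameters are
`(s², r(s+1), -s + r² + 3r, r² + r)`. -/
def IsNegativeLatinSquareType {V : Type*} [Fintype V] [DecidableEq V] (Γ : SimpleGraph V)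
    [DecidableRel Γ.Adj] : Prop :=
  ∃ s r l m : ℕ, (l : ℤ) = -(s : ℤ) + (r : ℤ) ^ 2 + 3 * (r : ℤ) ∧ m = r ^ 2 + r ∧
    Γ.IsSRGWith (s ^ 2) (r * (s + 1)) l m

/-- The set `Im(F) \ {0}`. -/
def nonzeroImage {K : Type*} [Field K] [Fintype K] [DecidableEq K] (F : K → K) : Finset K :=
  (Finset.univ.image F).erase 0

/-! Put `q = p ^ n`, `e = gcd(d, q - 1) = p ^ t + 1`. Then `F` has the fibres of `x ↦ x ^ e`, so its
exponents are multiples of `e`; having weight at most 2, they are of the form `p ^ i + p ^ j`, and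
`F` has a biadditive polarization `B`. Nonzero values are taken `e` times, so difference counts in
`D` amount to counting solutions of `F x - F y = g`, where `F (y + z) - F y = B z y + F z`.

If `e = 2`, `B z` is bijective for `z ≠ 0`, and the count is `q - 1`.

If `t > 0`, put `Q = -p ^ t`, so `q = Q ^ (2 * k)`, and let `S b = ∑ ψ (b * F x)`. Some `ω` gives `F
(ω * x) = -F x`, whence `S (-b) = S b` and `S b ^ 2` is 0 or `q` times the order of a radical. That
order is 1 modulo `e`, hence some `Q ^ (2 * j)`; the congruence `S b ≡ 1` mod `e` excludes 0 and
fixes the sign, so `S b = Q ^ (k + j)` (`weilSum_eq_neg_pow`). The first two moments of `S` then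
force `S b ∈ {Q ^ k, Q ^ (k + 1)}` for `b ≠ 0`. So `S ^ 2` is affine in `S` away from 0, and Fourier
inversion gives the counts (`card_sub_eq_of_weilSum`). -/

/-! ### Digit sums and divisibility by `p ^ t + 1`. -/

theorem exists_powers_of_digits_sum {p : ℕ} (hp : 1 < p) (m : ℕ) :
    ∃ l : List ℕ, l.length = pWeight p m ∧ m = (l.map (p ^ ·)).sum := by
  induction m using Nat.strong_induction_on with
  | _ m ih =>
    rcases Nat.eq_zero_or_pos m with rfl | hm
    · exact ⟨[], by simp [pWeight], by simp⟩
    · obtain ⟨l, hl, hs⟩ := ih (m / p) (Nat.div_lt_self hm hp)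
      refine ⟨List.replicate (m % p) 0 ++ l.map (· + 1), ?_, ?_⟩
      · have : pWeight p m = m % p + pWeight p (m / p) := by
          unfold pWeight
          rw [Nat.digits_def' hp hm, List.sum_cons]
        simp [this, hl]
      · have : ((l.map (· + 1)).map (p ^ ·)).sum = p * (l.map (p ^ ·)).sum := by
          rw [← List.sum_map_mul_left, List.map_map]
          congr 1
          apply List.map_congr_left
          intro a _
          simp [pow_succ, mul_comm]
        rw [List.map_append, List.sum_append, this, ← hs]
        simp [Nat.mod_add_div]

/-- Weight 1 is impossible: `e > 1` is coprime to `p` and cannot divide a power of `p`. -/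
theorem eq_pow_add_pow_of_pWeight_le_two {p e m : ℕ} (hp : p.Prime) (hm : m ≠ 0)
    (he : 1 < e) (hpe : e.Coprime p) (hem : e ∣ m) (hw : pWeight p m ≤ 2) :
    ∃ i j : ℕ, m = p ^ i + p ^ j := by
  obtain ⟨l, hl, hs⟩ := exists_powers_of_digits_sum hp.one_lt m
  match l, hl, hs with
  | [], _, hs => simp at hs; exact absurd hs hm
  | [i], _, hs =>
    simp only [List.map_cons, List.map_nil, List.sum_cons, List.sum_nil, add_zero] at hs
    rw [hs] at hem
    have := Nat.Coprime.eq_one_of_dvd (hpe.pow_right i) hem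
    omega
  | [i, j], _, hs => exact ⟨i, j, by simpa using hs⟩
  | a :: b :: c :: l, hl, _ => simp at hl; omega

/-- The order of `p` modulo `p ^ t + 1` is `2 * t`: reduce `a` below `2 * t` and compare sizes. -/
theorem two_mul_dvd_of_pow_add_one_dvd {p t : ℕ} (hp : 1 < p) (ht : 0 < t) (a : ℕ)
    (h : (p : ℤ) ^ t + 1 ∣ (p : ℤ) ^ a - 1) : 2 * t ∣ a := by
  induction a using Nat.strong_induction_on with
  | _ a ih =>
    have hp' : (1 : ℤ) < p := by exact_mod_cast hp
    rcases le_or_gt (2 * t) a with h2 | h2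
    · obtain ⟨c, rfl⟩ := Nat.exists_eq_add_of_le h2
      refine (Nat.dvd_add_right (dvd_refl _)).2 (ih c (by omega) ?_)
      have : (p : ℤ) ^ c - 1 = ((p : ℤ) ^ (2 * t + c) - 1)
          - ((p : ℤ) ^ t + 1) * (((p : ℤ) ^ t - 1) * (p : ℤ) ^ c) := by ring
      rw [this]
      exact dvd_sub h (dvd_mul_right _ _)
    · rcases le_or_gt a t with h3 | h3
      · have h1 : (p : ℤ) ^ a ≤ (p : ℤ) ^ t := pow_le_pow_right₀ hp'.le h3
        have h0 : (1 : ℤ) ≤ (p : ℤ) ^ a := one_le_pow₀ hp'.le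
        have := Int.eq_zero_of_dvd_of_nonneg_of_lt (by linarith) (by linarith) h
        have ha : (p : ℤ) ^ a = 1 := by linarith
        have : a = 0 := by
          by_contra h0
          exact absurd ha (one_lt_pow₀ hp' h0).ne'
        simp [this]
      · exfalso
        obtain ⟨c, rfl⟩ := Nat.exists_eq_add_of_lt h3
        -- Since `p ^ t ≡ -1`, the exponent drops by `t` at the cost of a sign; the result is too
        -- small to be divisible.
        have h4 : (p : ℤ) ^ t + 1 ∣ (p : ℤ) ^ (c + 1) + 1 := by
          have : (p : ℤ) ^ (c + 1) + 1 = ((p : ℤ) ^ t + 1) * (p : ℤ) ^ (c + 1)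
            - ((p : ℤ) ^ (t + c + 1) - 1) := by ring
          rw [this]
          exact dvd_sub (dvd_mul_right _ _) h
        have h5 : (p : ℤ) ^ (c + 1) < (p : ℤ) ^ t := pow_lt_pow_right₀ hp' (by omega)
        have := Int.le_of_dvd (by positivity) h4
        linarith

theorem pow_add_one_dvd_pow_add_one {p t s : ℕ} (hp : 1 < p) (ht : 0 < t)
    (h : (p : ℤ) ^ t + 1 ∣ (p : ℤ) ^ s + 1) : 2 * t ∣ s + t := by
  apply two_mul_dvd_of_pow_add_one_dvd hp ht
  have : (p : ℤ) ^ (s + t) - 1 = ((p : ℤ) ^ s + 1) * (p : ℤ) ^ t - ((p : ℤ) ^ t + 1) := by ring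
  rw [this]
  exact dvd_sub (h.mul_right _) dvd_rfl
-- Exponents of the reduced polynomial.
-- The polynomials of `F (ω * x)` and `F x` agree at all `#K` points and have degree below `#K`, so
-- they coincide; comparing coefficients gives `ω ^ m = 1`.
open Polynomial in
theorem dvd_of_mem_support_reducedPolynomial {K : Type*} [Field K] [Fintype K] [DecidableEq K]
    {F : K → K} {e : ℕ} {ω : K} (hω : IsPrimitiveRoot ω e) (hF : ∀ x, F (ω * x) = F x)
    {m : ℕ} (hm : m ∈ (reducedPolynomial F).support) : e ∣ m := by
  rcases Nat.eq_zero_or_pos m with rfl | hm0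
  · exact dvd_zero e
  have hq := reducedPolynomial_degree_lt F
  have hcomp : (reducedPolynomial F).comp (C ω * X) = reducedPolynomial F := by
    have hdeg : ((reducedPolynomial F).comp (C ω * X)).degree < (Fintype.card K : WithBot ℕ) := by
      rw [degree_lt_iff_coeff_zero] at hq ⊢
      intro k hk
      rw [comp_C_mul_X_coeff, hq k hk, zero_mul]
    refine eq_of_degrees_lt_of_eval_finset_eq Finset.univ hdeg hq fun x _ => ?_
    simp [reducedPolynomial_eval, hF]
  have hc := congrArg (fun P => P.coeff m) hcomp
  simp only [comp_C_mul_X_coeff] at hc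
  exact hω.dvd_of_pow_eq_one m ((mul_eq_left₀ (mem_support_iff.1 hm)).1 hc)

theorem exists_isPrimitiveRoot_of_dvd_card_sub_one {K : Type*} [Field K] [Fintype K]
    {e : ℕ} (he : e ∣ Fintype.card K - 1) : ∃ ω : K, IsPrimitiveRoot ω e := by
  classical
  obtain ⟨g, hg⟩ := IsCyclic.exists_generator (α := Kˣ)
  have h1 : IsPrimitiveRoot g (Fintype.card K - 1) := by
    rw [IsPrimitiveRoot.iff_orderOf, orderOf_eq_card_of_forall_mem_zpowers hg,
      Nat.card_eq_fintype_card, Fintype.card_units]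
  obtain ⟨a, ha⟩ := he
  have hpos : 0 < Fintype.card K - 1 := Nat.sub_pos_of_lt Fintype.one_lt_card
  exact ⟨(g : K) ^ a, (IsPrimitiveRoot.coe_units_iff.2 h1).pow hpos (ha.trans (mul_comm _ _))⟩

/-- A function on a finite field that is zero at zero, has the same fibers as `x ↦ x ^ e` for a
divisor `e` of `#K - 1`, and whose polarization is biadditive. -/
structure IsPowerLikeQuadratic {K : Type*} [Field K] [Fintype K] (e : ℕ) (F : K → K) : Prop where
  map_zero : F 0 = 0
  eq_iff : ∀ x y, F x = F y ↔ x ^ e = y ^ e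
  dvd : e ∣ Fintype.card K - 1
  map_add_add : ∀ x y z, F (x + y + z) + F x + F y + F z = F (x + y) + F (x + z) + F (y + z)

theorem pow_eq_pow_iff_pow_gcd_eq {K : Type*} [Field K] [Fintype K] {d e : ℕ} (hd : 0 < d)
    (he : d.gcd (Fintype.card K - 1) = e) (x y : K) : x ^ d = y ^ d ↔ x ^ e = y ^ e := by
  have he0 : e ≠ 0 := by rw [← he]; exact (Nat.gcd_pos_of_pos_left _ hd).ne'
  rcases eq_or_ne y 0 with rfl | hy
  · simp [hd.ne', he0]
  rcases eq_or_ne x 0 with rfl | hx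
  · simp [hd.ne', he0, eq_comm (a := (0 : K)), hy]
  have key : ∀ k : ℕ, x ^ k = y ^ k ↔ (x / y) ^ k = 1 := fun k => by
    rw [div_pow, div_eq_one_iff_eq (pow_ne_zero _ hy)]
  rw [key, key, ← he, pow_gcd_eq_one, and_iff_left]
  exact FiniteField.pow_card_sub_one_eq_one _ (div_ne_zero hx hy)

theorem exists_eq_pow_add_pow_of_mem_support {p n e : ℕ} (hp : p.Prime) {K : Type*} [Field K]
    [Fintype K] [DecidableEq K] (hK : Fintype.card K = p ^ n) (he : 1 < e) {F : K → K}
    (hF0 : F 0 = 0) (hdvd : e ∣ Fintype.card K - 1) (hF : ∀ x y, F x = F y ↔ x ^ e = y ^ e)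
    (hquad : algebraicDegree p F ≤ 2) {m : ℕ} (hm : m ∈ (reducedPolynomial F).support) :
    e ∣ m ∧ ∃ i j, m = p ^ i + p ^ j := by
  obtain ⟨ω, hω⟩ := exists_isPrimitiveRoot_of_dvd_card_sub_one hdvd
  have hem : e ∣ m := dvd_of_mem_support_reducedPolynomial hω
    (fun x => (hF _ _).2 (by rw [mul_pow, hω.pow_eq_one, one_mul])) hm
  have hn : n ≠ 0 := by
    rintro rfl
    have := Fintype.one_lt_card (α := K)
    simp [hK] at this
  have hm0 : m ≠ 0 := by
    rintro rfl
    rw [Polynomial.mem_support_iff, Polynomial.coeff_zero_eq_eval_zero,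
      reducedPolynomial_eval] at hm
    exact hm hF0
  have hcop : e.Coprime p := by
    refine (Nat.Coprime.symm ((Nat.Prime.coprime_iff_not_dvd hp).2 fun h => ?_))
    have h1 : p ∣ p ^ n - 1 := h.trans (hK ▸ hdvd)
    have h2 : p ∣ p ^ n := dvd_pow_self p hn
    have h3 := (Nat.dvd_sub_iff_right (Nat.one_le_pow _ _ hp.pos) h2).1 h1
    exact hp.one_lt.ne' (Nat.dvd_one.1 h3)
  exact ⟨hem, eq_pow_add_pow_of_pWeight_le_two hp hm0 he hcop hem
    ((Finset.le_sup (f := pWeight p) hm).trans hquad)⟩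

theorem charP_of_card_eq_prime_pow' {p n : ℕ} (hp : p.Prime) {K : Type*} [Field K]
    [Fintype K] (hK : Fintype.card K = p ^ n) : CharP K p := by
  have : Fact p.Prime := ⟨hp⟩
  exact charP_of_card_eq_prime_pow hK

theorem eq_sum_support_reducedPolynomial {K : Type*} [Field K] [Fintype K] [DecidableEq K]
    (F : K → K) (x : K) : F x = ∑ m ∈ (reducedPolynomial F).support,
      (reducedPolynomial F).coeff m * x ^ m := by
  conv_lhs => rw [← reducedPolynomial_eval F x, Polynomial.eval_eq_sum, Polynomial.sum]

/-- Each monomial `x ^ (p ^ i + p ^ j)` is a product of two additive maps, so the identity for the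
polarization holds term by term. -/
theorem isPowerLikeQuadratic_of_isQuadratic {p n d e : ℕ} (hp : p.Prime) {K : Type*} [Field K]
    [Fintype K] [DecidableEq K] (hK : Fintype.card K = p ^ n) (hd : 0 < d)
    (hgcd : Nat.gcd d (p ^ n - 1) = e) (he : 1 < e)
    {F G : K → K} (hFG : ∀ x, F x = G (x ^ d)) (hF0 : F 0 = 0) (hquad : IsQuadratic p F)
    (hG : Set.InjOn G (Set.range fun x : K => x ^ d)) : IsPowerLikeQuadratic e F := by
  have := charP_of_card_eq_prime_pow' hp hK
  have : Fact p.Prime := ⟨hp⟩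
  rw [← hK] at hgcd
  have hdvd : e ∣ Fintype.card K - 1 := hgcd ▸ Nat.gcd_dvd_right _ _
  have hF : ∀ x y, F x = F y ↔ x ^ e = y ^ e := fun x y => by
    rw [← pow_eq_pow_iff_pow_gcd_eq hd hgcd, hFG, hFG]
    exact hG.eq_iff ⟨x, rfl⟩ ⟨y, rfl⟩
  refine ⟨hF0, hF, hdvd, fun x y z => ?_⟩
  simp only [eq_sum_support_reducedPolynomial F (_ + _), eq_sum_support_reducedPolynomial F x,
    eq_sum_support_reducedPolynomial F y, eq_sum_support_reducedPolynomial F z,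
    ← Finset.sum_add_distrib]
  refine Finset.sum_congr rfl fun m hm => ?_
  obtain ⟨-, i, j, rfl⟩ :=
    exists_eq_pow_add_pow_of_mem_support hp hK he hF0 hdvd hF hquad.le hm
  simp only [pow_add _ (p ^ i), add_pow_char_pow]
  ring

/-- Every exponent is `p ^ i * (p ^ s + 1)` with `p ^ t + 1 ∣ p ^ s + 1`. Then `2 * t ∣ s + t`, and
as `ω` is fixed by the `2 * t`-th Frobenius iterate, `ω ^ p ^ s = ω ^ p ^ t`: each monomial changes
sign. -/
theorem map_mul_eq_neg_of_pow_eq_neg_one {p n t : ℕ} (hp : p.Prime) {K : Type*} [Field K]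
    [Fintype K] [DecidableEq K] (hK : Fintype.card K = p ^ n) (ht : 0 < t) {F : K → K}
    (hF : IsPowerLikeQuadratic (p ^ t + 1) F) (hquad : algebraicDegree p F ≤ 2) {ω : K}
    (hω : ω ^ (p ^ t + 1) = -1) (x : K) : F (ω * x) = -F x := by
  have := charP_of_card_eq_prime_pow' hp hK
  have : Fact p.Prime := ⟨hp⟩
  have hω0 : ω ≠ 0 := by rintro rfl; simp at hω
  have hω2 : ω ^ p ^ (2 * t) = ω := by
    have h1 : (ω ^ p ^ t * ω) ^ p ^ t = -1 := by
      rw [← pow_succ, hω, neg_one_pow_char_pow]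
    rw [mul_pow, ← pow_mul, show p ^ t * p ^ t = p ^ (2 * t) by ring] at h1
    apply mul_right_cancel₀ (pow_ne_zero (p ^ t) hω0)
    rw [h1, ← hω, pow_succ, mul_comm]
  have hω3 : ∀ c, ω ^ p ^ (2 * t * c) = ω := by
    intro c
    induction c with
    | zero => simp
    | succ c ih => rw [mul_add_one, pow_add, pow_mul, ih, hω2]
  have hω4 : ∀ s, p ^ t + 1 ∣ p ^ s + 1 → ω ^ (p ^ s + 1) = -1 := by
    intro s hs
    obtain ⟨c, hc⟩ := pow_add_one_dvd_pow_add_one hp.one_lt ht (s := s) (by exact_mod_cast hs)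
    have h1 : (ω ^ p ^ s) ^ p ^ t = (ω ^ p ^ t) ^ p ^ t := by
      rw [← pow_mul, ← pow_add, hc, hω3, ← pow_mul, ← pow_add, ← two_mul, hω2]
    have h2 : ω ^ p ^ s = ω ^ p ^ t :=
      iterateFrobenius_inj K p t (by simpa [iterateFrobenius_def] using h1)
    rw [pow_succ, h2, ← pow_succ, hω]
  have hcop : (p ^ t + 1).Coprime p := by
    obtain ⟨u, rfl⟩ := Nat.exists_eq_add_of_lt ht
    simp [pow_succ]
  have he : 1 < p ^ t + 1 := by have := pow_pos hp.pos t; omega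
  have key : ∀ i j, p ^ t + 1 ∣ p ^ i + p ^ j → i ≤ j → ω ^ (p ^ i + p ^ j) = -1 := by
    intro i j h hij
    obtain ⟨s, rfl⟩ := Nat.exists_eq_add_of_le hij
    have : p ^ i + p ^ (i + s) = (p ^ s + 1) * p ^ i := by ring
    rw [this] at h ⊢
    rw [pow_mul, hω4 s ((hcop.pow_right i).dvd_of_dvd_mul_right h), neg_one_pow_char_pow]
  rw [eq_sum_support_reducedPolynomial F (_ * _), eq_sum_support_reducedPolynomial F x,
    ← Finset.sum_neg_distrib]
  refine Finset.sum_congr rfl fun m hm => ?_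
  obtain ⟨hem, i, j, rfl⟩ := exists_eq_pow_add_pow_of_mem_support hp hK he
    hF.map_zero hF.dvd hF.eq_iff hquad hm
  have : ω ^ (p ^ i + p ^ j) = -1 := by
    rcases le_total i j with h | h
    · exact key i j hem h
    · rw [add_comm (p ^ i)] at hem ⊢
      exact key j i hem h
  rw [mul_pow, this]
  ring

/-! ### Fibres of `F` and counting differences. -/

namespace IsPowerLikeQuadratic

variable {K : Type*} [Field K] [Fintype K] {e : ℕ} {F : K → K}

theorem pos (hF : IsPowerLikeQuadratic e F) : 0 < e :=
  Nat.pos_of_dvd_of_pos hF.dvd (Nat.sub_pos_of_lt Fintype.one_lt_card)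

theorem eq_zero_iff (hF : IsPowerLikeQuadratic e F) {x : K} : F x = 0 ↔ x = 0 := by
  conv_lhs => rw [← hF.map_zero, hF.eq_iff, zero_pow hF.pos.ne', pow_eq_zero_iff hF.pos.ne']

theorem card_fiber [DecidableEq K] (hF : IsPowerLikeQuadratic e F) {x : K} (hx : x ≠ 0) :
    (Finset.univ.filter fun y => F y = F x).card = e := by
  obtain ⟨ω, hω⟩ := exists_isPrimitiveRoot_of_dvd_card_sub_one hF.dvd
  rw [← hω.card_nthRootsFinset]
  refine (Finset.card_bij (fun ζ _ => ζ * x) ?_ ?_ ?_).symm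
  · intro ζ hζ
    rw [Polynomial.mem_nthRootsFinset hF.pos] at hζ
    simp [hF.eq_iff, mul_pow, hζ]
  · intro a _ b _ h
    exact mul_right_cancel₀ hx h
  · intro y hy
    simp only [Finset.mem_filter, Finset.mem_univ, true_and, hF.eq_iff] at hy
    refine ⟨y / x, ?_, div_mul_cancel₀ _ hx⟩
    rw [Polynomial.mem_nthRootsFinset hF.pos, div_pow, hy, div_self (pow_ne_zero _ hx)]

theorem dvd_card [DecidableEq K] (hF : IsPowerLikeQuadratic e F) (R : Finset K) (h0 : 0 ∉ R)
    (hR : ∀ x ∈ R, ∀ y, F y = F x → y ∈ R) : R.card = (R.image F).card * e := by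
  rw [Finset.card_eq_sum_card_fiberwise (f := F) (t := R.image F)
    (fun x hx => Finset.mem_image_of_mem F hx), Finset.sum_const_nat]
  intro b hb
  obtain ⟨x, hx, rfl⟩ := Finset.mem_image.1 hb
  rw [← hF.card_fiber (x := x) (fun h => h0 (h ▸ hx))]
  congr 1
  ext y
  simp only [Finset.mem_filter, Finset.mem_univ, true_and, and_iff_right_iff_imp]
  exact hR x hx y

theorem mem_nonzeroImage [DecidableEq K] (hF : IsPowerLikeQuadratic e F) {g : K} :
    g ∈ nonzeroImage F ↔ ∃ x ≠ 0, F x = g := by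
  simp only [nonzeroImage, Finset.mem_erase, Finset.mem_image, Finset.mem_univ, true_and]
  constructor
  · rintro ⟨h, x, rfl⟩
    exact ⟨x, fun hx => h (hF.eq_zero_iff.2 hx), rfl⟩
  · rintro ⟨x, hx, rfl⟩
    exact ⟨fun h => hx (hF.eq_zero_iff.1 h), x, rfl⟩

theorem image_erase_zero [DecidableEq K] (hF : IsPowerLikeQuadratic e F) :
    (Finset.univ.erase 0).image F = nonzeroImage F := by
  ext g
  simp [hF.mem_nonzeroImage]

theorem card_nonzeroImage [DecidableEq K] (hF : IsPowerLikeQuadratic e F) :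
    (nonzeroImage F).card * e = Fintype.card K - 1 := by
  rw [← hF.image_erase_zero, ← hF.dvd_card _ (by simp), Finset.card_erase_of_mem (by simp),
    Finset.card_univ]
  intro x hx y hy
  simp only [Finset.mem_erase, Finset.mem_univ, and_true] at hx ⊢
  rintro rfl
  exact hx (hF.eq_zero_iff.1 (hy.symm.trans hF.map_zero))

theorem sum_comp [DecidableEq K] (hF : IsPowerLikeQuadratic e F) {M : Type*} [AddCommMonoid M]
    (f : K → M) : ∑ x, f (F x) = f 0 + e • ∑ y ∈ nonzeroImage F, f y := by
  rw [← Finset.add_sum_erase _ _ (Finset.mem_univ (0 : K)), hF.map_zero, Finset.sum_comp,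
    hF.image_erase_zero, Finset.smul_sum]
  congr 1
  refine Finset.sum_congr rfl fun g hg => ?_
  obtain ⟨x, hx, rfl⟩ := hF.mem_nonzeroImage.1 hg
  congr 1
  rw [← hF.card_fiber hx]
  congr 1
  ext y
  simp only [Finset.mem_filter, Finset.mem_univ, true_and, Finset.mem_erase, and_true,
    and_iff_right_iff_imp]
  rintro h rfl
  exact hx (hF.eq_zero_iff.1 (h.symm.trans hF.map_zero))

/-- The two indicator terms come from `y = 0` and `x = 0`, the only points with fibres of size 1. -/
theorem card_sub_eq [DecidableEq K] (hF : IsPowerLikeQuadratic e F) {g : K} (hg : g ≠ 0) :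
    (∑ x, ∑ y, if F x - F y = g then 1 else 0) = e ^ 2 * diffCount (nonzeroImage F) g
      + e * (if g ∈ nonzeroImage F then 1 else 0) + e * (if -g ∈ nonzeroImage F then 1 else 0) := by
  have hd : diffCount (nonzeroImage F) g = ∑ x ∈ nonzeroImage F, ∑ y ∈ nonzeroImage F,
      if x - y = g then 1 else 0 := by
    rw [diffCount, Finset.card_filter, Finset.sum_product]
    refine Finset.sum_congr rfl fun x _ => Finset.sum_congr rfl fun y _ => if_congr ?_ rfl rfl
    exact ⟨And.right, fun h => ⟨fun hxy => hg (h.symm.trans (sub_eq_zero.2 hxy)), h⟩⟩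
  have h1 : ∀ x, (∑ y, if F x - F y = g then 1 else 0)
      = (if F x = g then 1 else 0) + e * ∑ y ∈ nonzeroImage F, if F x - y = g then 1 else 0 := by
    intro x
    have := hF.sum_comp (fun y => if F x - y = g then 1 else 0)
    simpa using this
  simp_rw [h1, Finset.sum_add_distrib, ← Finset.mul_sum]
  rw [hF.sum_comp (fun x => if x = g then 1 else 0),
    hF.sum_comp (fun x => ∑ y ∈ nonzeroImage F, if x - y = g then 1 else 0), hd]
  have h2 : (∑ y ∈ nonzeroImage F, if 0 - y = g then 1 else 0)
      = if -g ∈ nonzeroImage F then 1 else 0 := by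
    simp_rw [zero_sub, neg_eq_iff_eq_neg]
    simp
  rw [h2]
  simp only [hg.symm, if_false, smul_eq_mul, zero_add,
    Finset.sum_ite_eq']
  ring

end IsPowerLikeQuadratic

/-! ### Polarization and the case `e = 2`. -/

namespace IsPowerLikeQuadratic

variable {K : Type*} [Field K] [Fintype K] {e : ℕ} {F : K → K}

/-- The polarization `y ↦ F (y + z) - F y - F z` of `F` at `z`. -/
def polar (hF : IsPowerLikeQuadratic e F) (z : K) : K →+ K where
  toFun y := F (y + z) - F y - F z
  map_zero' := by simp [hF.map_zero]
  map_add' x y := by linear_combination hF.map_add_add x y z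

theorem polar_apply (hF : IsPowerLikeQuadratic e F) (z y : K) :
    hF.polar z y = F (y + z) - F y - F z := rfl

theorem polar_comm (hF : IsPowerLikeQuadratic e F) (z y : K) :
    hF.polar z y = hF.polar y z := by
  rw [polar_apply, polar_apply, add_comm]
  ring

theorem sum_sum_eq_sum_polar (hF : IsPowerLikeQuadratic e F) {M : Type*} [AddCommMonoid M]
    (f : K → M) : ∑ x, ∑ y, f (F x - F y) = ∑ z, ∑ y, f (hF.polar z y + F z) := by
  rw [Finset.sum_comm, Finset.sum_comm (s := Finset.univ) (f := fun z y => f (hF.polar z y + F z))]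
  refine Finset.sum_congr rfl fun y _ => ?_
  rw [← Equiv.sum_comp (Equiv.addLeft y)]
  refine Finset.sum_congr rfl fun z _ => ?_
  rw [Equiv.coe_addLeft, polar_apply, sub_add_cancel]

/-- As `F` is even, a zero `y` of `hF.polar z` satisfies `F (y + z) = F (y - z)`, so `(y + z) ^ 2 =
(y - z) ^ 2` and `4 * z * y = 0`. -/
theorem polar_injective (hF : IsPowerLikeQuadratic 2 F) (h2 : (2 : K) ≠ 0) {z : K} (hz : z ≠ 0) :
    Function.Injective (hF.polar z) := by
  rw [injective_iff_map_eq_zero]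
  intro y hy
  have h1 : F (-z) = F z := (hF.eq_iff _ _).2 (neg_sq z)
  have h3 : hF.polar (-z) y = 0 := by
    rw [polar_comm, map_neg, polar_comm, hy, neg_zero]
  rw [polar_apply] at hy h3
  have h4 : F (y + z) = F (y + -z) := by linear_combination hy - h3 - h1
  rw [hF.eq_iff] at h4
  have h5 : 2 * (2 * z * y) = 0 := by linear_combination h4
  simpa [h2, hz] using h5

theorem card_sub_eq_of_two [DecidableEq K] (hF : IsPowerLikeQuadratic 2 F) (h2 : (2 : K) ≠ 0)
    {g : K} (hg : g ≠ 0) :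
    (∑ x, ∑ y, if F x - F y = g then 1 else 0) = Fintype.card K - 1 := by
  rw [hF.sum_sum_eq_sum_polar (fun w => if w = g then 1 else 0),
    ← Finset.add_sum_erase _ _ (Finset.mem_univ (0 : K))]
  have h0 : (∑ y, if hF.polar 0 y + F 0 = g then 1 else 0) = 0 :=
    Finset.sum_eq_zero fun y _ => if_neg <| by
      rw [polar_comm, AddMonoidHom.map_zero, zero_add, hF.map_zero]
      exact hg.symm
  rw [h0, zero_add, Finset.sum_congr rfl (g := fun _ => 1), Finset.sum_const,
    Finset.card_erase_of_mem (Finset.mem_univ _), Finset.card_univ, smul_eq_mul, mul_one]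
  intro z hz
  have hb : Function.Bijective (hF.polar z) :=
    Finite.injective_iff_bijective.1 (hF.polar_injective h2 (Finset.ne_of_mem_erase hz))
  rw [hb.sum_comp (fun w => if w + F z = g then 1 else 0)]
  simp [← eq_sub_iff_add_eq]

theorem isDifferenceSet_or_isPartialDifferenceSet [DecidableEq K]
    (hF : IsPowerLikeQuadratic 2 F) (h2 : (2 : K) ≠ 0) {q : ℕ} (hq : Fintype.card K = q) :
    (q % 4 = 3 → IsDifferenceSet (nonzeroImage F) q ((q - 1) / 2) ((q - 3) / 4)) ∧
    (q % 4 = 1 →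
      IsPartialDifferenceSet (nonzeroImage F) q ((q - 1) / 2) ((q - 5) / 4) ((q - 1) / 4)) := by
  have hcard : (nonzeroImage F).card = (q - 1) / 2 := by
    have := hF.card_nonzeroImage
    omega
  -- Modulo 4 this decides how many of `g`, `-g` lie in `D`: exactly one if `q % 4 = 3`, both or
  -- neither if `q % 4 = 1`.
  have hcount : ∀ g : K, g ≠ 0 → 4 * diffCount (nonzeroImage F) g
      + 2 * (if g ∈ nonzeroImage F then 1 else 0)
      + 2 * (if -g ∈ nonzeroImage F then 1 else 0) = q - 1 := by
    intro g hg
    rw [← hq, ← hF.card_sub_eq_of_two h2 hg, hF.card_sub_eq hg]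
    norm_num
  refine ⟨fun h => ⟨hq, hcard, fun g hg => ?_⟩,
    fun h => ⟨hq, hcard, by simp [nonzeroImage], fun g hg => ?_, fun g hg hg0 => ?_⟩⟩
  · have := hcount g hg
    split_ifs at this <;> omega
  · have := hcount g fun h0 => by simp [h0, nonzeroImage] at hg
    rw [if_pos hg] at this
    split_ifs at this <;> omega
  · have := hcount g hg0
    rw [if_neg hg] at this
    split_ifs at this <;> omega

end IsPowerLikeQuadratic

/-! ### From partial difference sets to strongly regular graphs. -/

theorem IsRegularPartialDifferenceSet.isSRGWith {A : Type*} [AddGroup A] [Fintype A]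
    [DecidableEq A] {D : Finset A} {v k l m : ℕ} (h : IsRegularPartialDifferenceSet D v k l m) :
    (cayleyGraph D).IsSRGWith v k l m := by
  have hadj := cayleyGraph_adj D h.zero_notMem h.neg_mem
  have hcommon : ∀ a b : A, a ≠ b →
      Fintype.card ((cayleyGraph D).commonNeighbors a b) = diffCount D (a - b) := by
    intro a b hab
    rw [diffCount, ← Set.toFinset_card]
    refine Finset.card_bij (fun u _ => (a - u, b - u)) ?_ ?_ ?_
    · intro u hu
      rw [Set.mem_toFinset, SimpleGraph.mem_commonNeighbors, hadj, hadj] at hu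
      simp [hu, hab]
    · intro u _ w _ huw
      exact sub_right_injective (Prod.mk.inj huw).1
    · rintro ⟨x, y⟩ hxy
      simp only [Finset.mem_filter, Finset.mem_product] at hxy
      obtain ⟨⟨hx, hy⟩, -, hd⟩ := hxy
      -- The group need not be commutative, so `a - u = x` is solved by `u = -x + a`.
      have hbx : b - (-x + a) = y := by
        have : b - (-x + a) = -(a - b) + x := by
          simp [sub_eq_add_neg, add_assoc]
        rw [this, ← hd]
        simp
      refine ⟨-x + a, ?_, ?_⟩
      · rw [Set.mem_toFinset, SimpleGraph.mem_commonNeighbors, hadj, hadj, hbx]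
        simpa [hy] using hx
      · simp [hbx]
  refine ⟨h.card_group, fun a => ?_, fun a b hab => ?_, fun a b hab hn => ?_⟩
  · rw [← h.card_eq, ← SimpleGraph.card_neighborFinset_eq_degree]
    refine Finset.card_bij (fun u _ => a - u) ?_ ?_ ?_
    · intro u hu
      rwa [SimpleGraph.mem_neighborFinset, hadj] at hu
    · intro u _ w _ huw
      exact sub_right_injective huw
    · intro x hx
      refine ⟨-x + a, ?_, ?_⟩
      · rw [SimpleGraph.mem_neighborFinset, hadj]
        simpa using hx
      · simp
  · rw [hcommon a b hab.ne, h.diffCount_of_mem _ ((hadj a b).1 hab)]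
  · rw [hcommon a b hab, h.diffCount_of_notMem _ (fun hm => hn ((hadj a b).2 hm))
      (sub_ne_zero.2 hab)]

/-! ### Weil sums and their radicals. -/

/-- `T` is rational and an algebraic integer, hence an integer. This yields the congruence modulo
`e` for integral Weil sums. -/
theorem dvd_sub_one_of_one_add_mul_isIntegral {e m : ℤ} (he : e ≠ 0) {T : ℂ}
    (hT : IsIntegral ℤ T) (h : (m : ℂ) = 1 + e * T) : e ∣ m - 1 := by
  have he' : (e : ℂ) ≠ 0 := by exact_mod_cast he
  have h1 : T = algebraMap ℚ ℂ (((m : ℚ) - 1) / e) := by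
    rw [map_div₀, eq_div_iff (by simpa using he)]
    simp only [map_sub, map_intCast, map_one]
    linear_combination -h
  rw [h1, isIntegral_algebraMap_iff (algebraMap ℚ ℂ).injective] at hT
  obtain ⟨c, hc⟩ := IsIntegrallyClosed.isIntegral_iff.1 hT
  refine ⟨c, ?_⟩
  have he'' : (e : ℚ) ≠ 0 := by exact_mod_cast he
  rw [eq_div_iff he''] at hc
  simp only [algebraMap_int_eq, eq_intCast] at hc
  have : (m : ℚ) - 1 = e * c := by rw [← hc, mul_comm]
  exact_mod_cast this

theorem isIntegral_addChar_apply {A : Type*} [AddGroup A] [Finite A] (ψ : AddChar A ℂ) (a : A) :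
    IsIntegral ℤ (ψ a) := by
  have h : ψ a ^ addOrderOf a = 1 := by
    rw [← AddChar.map_nsmul_eq_pow, addOrderOf_nsmul_eq_zero, AddChar.map_zero_eq_one]
  exact IsIntegral.of_pow (addOrderOf_pos a) (h ▸ isIntegral_one)

namespace IsPowerLikeQuadratic

variable {K : Type*} [Field K] [Fintype K] {e : ℕ} {F : K → K}

theorem map_mul_of_pow_eq_one (hF : IsPowerLikeQuadratic e F) {ω : K} (hω : ω ^ e = 1) (x : K) :
    F (ω * x) = F x := by
  rw [hF.eq_iff, mul_pow, hω, one_mul]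

/-- The Weil sum `∑ ψ (b F x)`. -/
noncomputable def weilSum (ψ : AddChar K ℂ) (F : K → K) (b : K) : ℂ := ∑ x, ψ (b * F x)

theorem weilSum_neg {ψ : AddChar K ℂ} {ω : K} (hω : ω ≠ 0) (h : ∀ x, F (ω * x) = -F x) (b : K) :
    weilSum ψ F (-b) = weilSum ψ F b := by
  rw [weilSum, ← Equiv.sum_comp (Equiv.mulLeft₀ ω hω)]
  simp [h, weilSum]

theorem weilSum_eq [DecidableEq K] (hF : IsPowerLikeQuadratic e F) (ψ : AddChar K ℂ) (b : K) :
    weilSum ψ F b = 1 + e * ∑ y ∈ nonzeroImage F, ψ (b * y) := by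
  rw [weilSum, hF.sum_comp (fun y => ψ (b * y))]
  simp

theorem dvd_sub_one_of_weilSum_eq (hF : IsPowerLikeQuadratic e F)
    {ψ : AddChar K ℂ} {b : K} {m : ℤ} (h : weilSum ψ F b = m) : (e : ℤ) ∣ m - 1 := by
  classical
  refine dvd_sub_one_of_one_add_mul_isIntegral (T := ∑ y ∈ nonzeroImage F, ψ (b * y))
    (by exact_mod_cast hF.pos.ne')
    (IsIntegral.sum _ fun y _ => isIntegral_addChar_apply ψ _) ?_
  rw [← h, hF.weilSum_eq]
  simp

theorem sum_weilSum_mul [DecidableEq K] {ψ : AddChar K ℂ} (hψ : ψ.IsPrimitive) (g : K) :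
    ∑ b, weilSum ψ F b * ψ (-(b * g)) =
      Fintype.card K * ∑ x, if F x = g then 1 else 0 := by
  simp_rw [weilSum, Finset.sum_mul, ← AddChar.map_add_eq_mul]
  rw [Finset.sum_comm, Finset.mul_sum]
  refine Finset.sum_congr rfl fun x _ => ?_
  simp_rw [← sub_eq_add_neg, ← mul_sub]
  rw [AddChar.sum_mulShift _ hψ]
  simp [sub_eq_zero]

theorem weilSum_mul_weilSum_neg (ψ : AddChar K ℂ) (b : K) :
    weilSum ψ F b * weilSum ψ F (-b) = ∑ x, ∑ y, ψ (b * (F x - F y)) := by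
  simp_rw [weilSum, Finset.sum_mul_sum, ← AddChar.map_add_eq_mul]
  refine Finset.sum_congr rfl fun x _ => Finset.sum_congr rfl fun y _ => ?_
  congr 1
  ring

theorem sum_weilSum_mul_weilSum_neg [DecidableEq K] {ψ : AddChar K ℂ} (hψ : ψ.IsPrimitive)
    (g : K) : ∑ b, weilSum ψ F b * weilSum ψ F (-b) * ψ (-(b * g)) =
      Fintype.card K * ∑ x, ∑ y, if F x - F y = g then 1 else 0 := by
  simp_rw [weilSum_mul_weilSum_neg, Finset.sum_mul, ← AddChar.map_add_eq_mul]
  rw [Finset.sum_comm, Finset.mul_sum]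
  refine Finset.sum_congr rfl fun x _ => ?_
  rw [Finset.sum_comm, Finset.mul_sum]
  refine Finset.sum_congr rfl fun y _ => ?_
  simp_rw [← sub_eq_add_neg, ← mul_sub]
  rw [AddChar.sum_mulShift _ hψ]
  simp [sub_eq_zero]

/-- The radical of the form `ψ (b F x)`. -/
def radical (hF : IsPowerLikeQuadratic e F) (ψ : AddChar K ℂ) (b : K) : AddSubgroup K where
  carrier := {z | ∀ y, ψ (b * hF.polar z y) = 1}
  zero_mem' y := by rw [polar_comm, AddMonoidHom.map_zero, mul_zero, AddChar.map_zero_eq_one]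
  add_mem' {z w} hz hw y := by
    rw [polar_comm, map_add, mul_add, AddChar.map_add_eq_mul, polar_comm, hz y, polar_comm, hw y,
      one_mul]
  neg_mem' {z} hz y := by
    rw [polar_comm, map_neg, polar_comm, ← map_neg]
    exact hz _

theorem mem_radical (hF : IsPowerLikeQuadratic e F) {ψ : AddChar K ℂ} {b z : K} :
    z ∈ hF.radical ψ b ↔ ∀ y, ψ (b * hF.polar z y) = 1 := Iff.rfl

/-- The radical is stable under `e`-th roots of unity, because `B (ω * x) y = B x (ω⁻¹ * y)`;
without 0 it is a union of fibres of size `e`. -/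
theorem dvd_card_radical_sub_one (hF : IsPowerLikeQuadratic e F) (ψ : AddChar K ℂ) (b : K) :
    e ∣ Nat.card (hF.radical ψ b) - 1 := by
  classical
  have h := hF.dvd_card ((Finset.univ.filter (· ∈ hF.radical ψ b)).erase 0) (by simp) ?_
  · rw [Finset.card_erase_of_mem (by simp)] at h
    rw [Nat.card_eq_fintype_card, Fintype.card_subtype, h]
    exact dvd_mul_left _ _
  intro x hx y hxy
  simp only [Finset.mem_erase, Finset.mem_filter, Finset.mem_univ, true_and] at hx ⊢
  have hy : y ≠ 0 := by
    rintro rfl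
    exact hx.1 (hF.eq_zero_iff.1 (hxy.symm.trans hF.map_zero))
  refine ⟨hy, fun w => ?_⟩
  rw [hF.eq_iff] at hxy
  have hω : (y / x) ^ e = 1 := by rw [div_pow, hxy, div_self (pow_ne_zero _ hx.1)]
  have h1 : y / x * x = y := div_mul_cancel₀ _ hx.1
  have h2 : y / x * (x / y * w) = w := by
    have := hx.1
    field_simp
  have h3 : hF.polar y w = hF.polar x (x / y * w) := by
    rw [polar_apply, polar_apply, ← hF.map_mul_of_pow_eq_one hω (x / y * w + x),
      ← hF.map_mul_of_pow_eq_one hω (x / y * w), ← hF.map_mul_of_pow_eq_one hω x, mul_add, h2, h1]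
  rw [h3]
  exact hx.2 _

/-- After substituting `x = y + z`, the sum over `y` vanishes unless `z` is in the radical. There `z
↦ ψ (b * F z)` is a character, so its sum is 0 or the order of the radical. -/
theorem weilSum_mul_weilSum_neg_eq (hF : IsPowerLikeQuadratic e F) (ψ : AddChar K ℂ) (b : K) :
    weilSum ψ F b * weilSum ψ F (-b) = 0 ∨
    weilSum ψ F b * weilSum ψ F (-b) = Fintype.card K * Nat.card (hF.radical ψ b) := by
  classical
  let χ : AddChar (hF.radical ψ b) ℂ :=
    { toFun := fun z => ψ (b * F z)
      map_zero_eq_one' := by simp [hF.map_zero]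
      map_add_eq_mul' := fun z w => by
        rw [← AddChar.map_add_eq_mul, ← mul_one (ψ (b * F z + b * F w)), ← w.2 z,
          ← AddChar.map_add_eq_mul, polar_apply]
        congr 1
        push_cast
        ring }
  have h1 : weilSum ψ F b * weilSum ψ F (-b) = Fintype.card K * ∑ z, χ z := by
    rw [weilSum_mul_weilSum_neg, hF.sum_sum_eq_sum_polar (fun w => ψ (b * w)), Finset.mul_sum,
      show ∑ z, (Fintype.card K : ℂ) * χ z =
          ∑ z ∈ Finset.univ.filter (· ∈ hF.radical ψ b), Fintype.card K * ψ (b * F z) from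
        (Finset.sum_subtype (Finset.univ.filter (· ∈ hF.radical ψ b)) (p := (· ∈ hF.radical ψ b))
           (fun z => Finset.mem_filter_univ z) (fun z => Fintype.card K * ψ (b * F z))).symm,
      Finset.sum_filter]
    refine Finset.sum_congr rfl fun z _ => ?_
    simp_rw [mul_add, AddChar.map_add_eq_mul, ← Finset.sum_mul]
    have h2 := AddChar.sum_eq_ite ((ψ.mulShift b).compAddMonoidHom (hF.polar z))
    have h3 : (ψ.mulShift b).compAddMonoidHom (hF.polar z) = 0 ↔ z ∈ hF.radical ψ b := by
      rw [DFunLike.ext_iff]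
      simp [mem_radical, AddChar.mulShift_apply]
    simp only [h3, AddChar.compAddMonoidHom_apply, AddChar.mulShift_apply] at h2
    rw [h2]
    split_ifs <;> simp
  rw [h1, AddChar.sum_eq_ite]
  split_ifs
  · right
    rw [Nat.card_eq_fintype_card]
  · left
    simp

theorem weilSum_eq_neg_pow {p t k : ℕ} (hp : p.Prime) (ht : 0 < t)
    (hK : Fintype.card K = p ^ (2 * k * t)) (hF : IsPowerLikeQuadratic (p ^ t + 1) F)
    {ω : K} (hω : ω ≠ 0) (hneg : ∀ x, F (ω * x) = -F x) (ψ : AddChar K ℂ) (b : K) :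
    ∃ j : ℕ, weilSum ψ F b = (((-(p : ℤ) ^ t) ^ (k + j) : ℤ) : ℂ) := by
  have hP : 2 ≤ (p : ℤ) ^ t := by
    have := Nat.one_lt_pow ht.ne' hp.one_lt
    exact_mod_cast this
  obtain ⟨a, -, ha⟩ := (Nat.dvd_prime_pow hp).1
    (hK ▸ Nat.card_eq_fintype_card (α := K) ▸ (hF.radical ψ b).card_addSubgroup_dvd_card)
  obtain ⟨j, rfl⟩ : 2 * t ∣ a := by
    apply two_mul_dvd_of_pow_add_one_dvd hp.one_lt ht
    have h := hF.dvd_card_radical_sub_one ψ b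
    rw [ha] at h
    zify [Nat.one_le_pow a p hp.pos] at h
    exact h
  have hsq := hF.weilSum_mul_weilSum_neg_eq ψ b
  rw [weilSum_neg hω hneg, ← sq] at hsq
  -- A zero sum would give `e ∣ -1`.
  have hS : weilSum ψ F b ≠ 0 := fun h => by
    have h1 := hF.dvd_sub_one_of_weilSum_eq (m := 0) (by simpa using h)
    have h2 := Int.le_of_dvd one_pos ((dvd_neg.2 h1).trans (by norm_num))
    push_cast at h2
    linarith
  have hsq' := hsq.resolve_left (pow_ne_zero 2 hS)
  rw [ha, hK] at hsq'
  have hsq2 : weilSum ψ F b ^ 2 = (((-(p : ℤ) ^ t) ^ (k + j) : ℤ) : ℂ) ^ 2 := by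
    rw [hsq']
    push_cast
    rw [← pow_mul, mul_comm (k + j), pow_mul (-(p : ℂ) ^ t), neg_sq]
    ring
  -- As `-p ^ t ≡ 1` modulo `e`, the opposite sign would give `e ∣ 2`, but `e ≥ 3`.
  refine ⟨j, (sq_eq_sq_iff_eq_or_eq_neg.1 hsq2).resolve_right fun h => ?_⟩
  have h1 := hF.dvd_sub_one_of_weilSum_eq (m := -(-(p : ℤ) ^ t) ^ (k + j))
    (by rw [h]; push_cast; rfl)
  push_cast at h1
  have h2 : (p : ℤ) ^ t + 1 ∣ (-(p : ℤ) ^ t) ^ (k + j) - 1 ^ (k + j) :=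
    dvd_trans ⟨-1, by ring⟩ (sub_dvd_pow_sub_pow (-(p : ℤ) ^ t) 1 (k + j))
  have h3 := dvd_add h1 h2
  rw [one_pow] at h3
  have h4 := Int.le_of_dvd two_pos ((dvd_neg.2 h3).trans ⟨1, by ring⟩)
  linarith

/-! ### Moments and Fourier inversion. -/

theorem sum_card_eq [DecidableEq K] (hF : IsPowerLikeQuadratic e F) (g : K) :
    (∑ x, if F x = g then 1 else 0 : ℤ) =
      (if g = 0 then 1 else 0) + e * (if g ∈ nonzeroImage F then 1 else 0) := by
  rw [hF.sum_comp (fun x => if x = g then (1 : ℤ) else 0)]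
  simp [eq_comm]

theorem sum_card_sub_zero [DecidableEq K] (hF : IsPowerLikeQuadratic e F) :
    (∑ x, ∑ y, if F x - F y = 0 then 1 else 0 : ℤ) = 1 + (Fintype.card K - 1) * e := by
  rw [Finset.sum_comm]
  have h : ∀ y : K, (∑ x, if F x - F y = 0 then 1 else 0 : ℤ) = if y = 0 then 1 else (e : ℤ) := by
    intro y
    simp_rw [sub_eq_zero]
    split_ifs with h
    · rw [h, hF.map_zero, hF.sum_card_eq]
      simp [nonzeroImage]
    · rw [Finset.sum_boole, hF.card_fiber h]
  simp_rw [h]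
  rw [← Finset.add_sum_erase _ _ (Finset.mem_univ (0 : K)), if_pos rfl,
    Finset.sum_congr rfl (g := fun _ => (e : ℤ)) (fun y hy => if_neg (Finset.ne_of_mem_erase hy)),
    Finset.sum_const, Finset.card_erase_of_mem (Finset.mem_univ _), Finset.card_univ, nsmul_eq_mul,
    Nat.cast_sub Fintype.card_pos, Nat.cast_one]

theorem card_sub_eq_of_weilSum [DecidableEq K] (hF : IsPowerLikeQuadratic e F) {Q : ℤ} {k : ℕ}
    (hQ : Q < 0) (he : (e : ℤ) = 1 - Q) (hq : (Fintype.card K : ℤ) = Q ^ (2 * k))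
    {ω : K} (hω : ω ≠ 0) (hneg : ∀ x, F (ω * x) = -F x) {ψ : AddChar K ℂ} (hψ : ψ.IsPrimitive)
    (hS : ∀ b, ∃ j : ℕ, weilSum ψ F b = ((Q ^ (k + j) : ℤ) : ℂ)) {g : K} (hg : g ≠ 0) :
    (∑ x, ∑ y, if F x - F y = g then 1 else 0 : ℤ) =
      Q ^ (2 * k) + Q + (Q ^ k + Q ^ (k + 1)) * (e * (if g ∈ nonzeroImage F then 1 else 0) - 1) := by
  choose j hj using hS
  have hS0 : weilSum ψ F 0 = ((Q ^ (2 * k) : ℤ) : ℂ) := by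
    rw [← hq]
    simp [weilSum]
  have hq0 : (Fintype.card K : ℤ) ≠ 0 := by exact_mod_cast Fintype.card_ne_zero
  have hm1 : ∑ b, Q ^ (k + j b) = Q ^ (2 * k) := by
    have h := sum_weilSum_mul (F := F) hψ 0
    simp only [mul_zero, neg_zero, AddChar.map_zero_eq_one, mul_one, hj] at h
    have h' : ∑ b, Q ^ (k + j b) = Fintype.card K * ∑ x, if F x = 0 then 1 else 0 := by
      exact_mod_cast h
    rw [h', hF.sum_card_eq, hq]
    simp [nonzeroImage]
  have hm2 : ∑ b, (Q ^ (k + j b)) ^ 2 = Q ^ (2 * k) * (1 + (Q ^ (2 * k) - 1) * e) := by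
    have h := sum_weilSum_mul_weilSum_neg (F := F) hψ 0
    simp only [weilSum_neg hω hneg, ← sq, mul_zero, neg_zero, AddChar.map_zero_eq_one, mul_one,
      hj] at h
    have h' : ∑ b, (Q ^ (k + j b)) ^ 2
        = Fintype.card K * ∑ x, ∑ y, if F x - F y = 0 then 1 else 0 := by
      exact_mod_cast h
    rw [h', hF.sum_card_sub_zero, hq]
  have hj0 : Q ^ (k + j 0) = Q ^ (2 * k) := by
    have := (hj 0).symm.trans hS0
    exact_mod_cast this
  -- No power `Q ^ i` lies strictly between `Q` and 1, so every term is nonnegative; by the two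
  -- moments the terms with `b ≠ 0` sum to 0.
  have hroots : ∀ b ≠ 0, (Q ^ (k + j b) - Q ^ k) * (Q ^ (k + j b) - Q ^ (k + 1)) = 0 := by
    have hnn : ∀ i : ℕ, 0 ≤ (Q ^ (k + i) - Q ^ k) * (Q ^ (k + i) - Q ^ (k + 1)) := by
      intro i
      have h1 : (Q ^ (k + i) - Q ^ k) * (Q ^ (k + i) - Q ^ (k + 1))
          = (Q ^ k) ^ 2 * ((Q ^ i - 1) * (Q ^ i - Q)) := by ring
      rw [h1]
      refine mul_nonneg (sq_nonneg _) ?_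
      rcases Nat.even_or_odd' i with ⟨c, rfl | rfl⟩
      · have h2 : 0 < Q ^ (2 * c) := (even_two_mul c).pow_pos hQ.ne
        exact mul_nonneg (by linarith) (by linarith)
      · have h2 : 0 < Q ^ (2 * c) := (even_two_mul c).pow_pos hQ.ne
        have h3 : Q ^ (2 * c + 1) ≤ Q := by
          rw [pow_succ]
          nlinarith
        exact mul_nonneg_of_nonpos_of_nonpos (by linarith) (by linarith)
    have hsum : ∑ b ∈ Finset.univ.erase 0,
        (Q ^ (k + j b) - Q ^ k) * (Q ^ (k + j b) - Q ^ (k + 1)) = 0 := by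
      have h1 : ∑ b, (Q ^ (k + j b) - Q ^ k) * (Q ^ (k + j b) - Q ^ (k + 1))
          = ∑ b, (Q ^ (k + j b)) ^ 2 - (Q ^ k + Q ^ (k + 1)) * ∑ b, Q ^ (k + j b)
            + Fintype.card K * (Q ^ k * Q ^ (k + 1)) := by
        rw [Finset.mul_sum, ← nsmul_eq_mul, ← Finset.card_univ, ← Finset.sum_const,
          ← Finset.sum_sub_distrib, ← Finset.sum_add_distrib]
        exact Finset.sum_congr rfl fun b _ => by ring
      rw [← Finset.add_sum_erase _ _ (Finset.mem_univ (0 : K)), hm1, hm2, hj0, hq, he] at h1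
      linear_combination h1
    intro b hb
    exact (Finset.sum_eq_zero_iff_of_nonneg fun b _ => hnn (j b)).1 hsum b
      (Finset.mem_erase.2 ⟨hb, Finset.mem_univ b⟩)
  -- The quadratic relation in linear form, corrected at `b = 0`, where the sum equals `#K`.
  have hsquare : ∀ b, weilSum ψ F b * weilSum ψ F (-b) =
      ((Q ^ k + Q ^ (k + 1) : ℤ) : ℂ) * weilSum ψ F b - ((Q ^ (2 * k + 1) : ℤ) : ℂ)
        + if b = 0 then
          (((Q ^ (2 * k)) ^ 2 - (Q ^ k + Q ^ (k + 1)) * Q ^ (2 * k) + Q ^ (2 * k + 1) : ℤ) : ℂ)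
          else 0 := by
    intro b
    rw [weilSum_neg hω hneg]
    split_ifs with hb
    · rw [hb, hS0]
      push_cast
      ring
    · rw [hj b]
      have h := hroots b hb
      have h' : Q ^ (k + j b) * Q ^ (k + j b)
          = (Q ^ k + Q ^ (k + 1)) * Q ^ (k + j b) - Q ^ (2 * k + 1) := by
        linear_combination h
      rw [add_zero]
      exact_mod_cast h'
  have hfinal := sum_weilSum_mul_weilSum_neg (F := F) hψ g
  have hψ0 : ∑ b, ψ (-(b * g)) = 0 := by
    have := AddChar.sum_mulShift (-g) hψ
    simpa [hg] using this
  simp_rw [hsquare, add_mul, sub_mul, Finset.sum_add_distrib, Finset.sum_sub_distrib, mul_assoc,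
    ← Finset.mul_sum] at hfinal
  rw [sum_weilSum_mul hψ, hψ0] at hfinal
  simp only [ite_mul, zero_mul, Finset.sum_ite_eq', Finset.mem_univ, if_true, neg_zero,
    AddChar.map_zero_eq_one, mul_one, mul_zero, sub_zero] at hfinal
  have hfinal' : (Q ^ k + Q ^ (k + 1)) * (Fintype.card K * ∑ x, if F x = g then 1 else 0)
      + ((Q ^ (2 * k)) ^ 2 - (Q ^ k * Q ^ (2 * k) + Q ^ (k + 1) * Q ^ (2 * k))
        + Q ^ (2 * k + 1)) = Fintype.card K * ∑ x, ∑ y, if F x - F y = g then 1 else 0 := by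
    exact_mod_cast hfinal
  rw [hF.sum_card_eq, if_neg hg] at hfinal'
  apply mul_left_cancel₀ hq0
  rw [← hfinal', hq]
  ring

end IsPowerLikeQuadratic

/-! ### The sign symmetry and the final parameters. -/

theorem exists_pow_eq_neg_one_of_two_mul_dvd {K : Type*} [Field K] [Fintype K] {e : ℕ}
    (he : 2 * e ∣ Fintype.card K - 1) : ∃ ω : K, ω ^ e = -1 := by
  obtain ⟨ω, hω⟩ := exists_isPrimitiveRoot_of_dvd_card_sub_one he
  have hpos : 0 < 2 * e := Nat.pos_of_dvd_of_pos he (Nat.sub_pos_of_lt Fintype.one_lt_card)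
  exact ⟨ω, (hω.pow hpos (mul_comm 2 e)).eq_neg_one_of_two_right⟩

theorem exists_mul_eq_neg {p k t : ℕ} (hp : p.Prime) {K : Type*} [Field K]
    [Fintype K] [DecidableEq K] (hK : Fintype.card K = p ^ (2 * k * t)) (ht : 0 < t) {F : K → K}
    (hF : IsPowerLikeQuadratic (p ^ t + 1) F) (hquad : algebraicDegree p F ≤ 2) :
    ∃ ω : K, ω ≠ 0 ∧ ∀ x, F (ω * x) = -F x := by
  rcases hp.eq_two_or_odd' with rfl | hodd
  · have := charP_of_card_eq_prime_pow' hp hK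
    exact ⟨1, one_ne_zero, fun x => by rw [one_mul, CharTwo.neg_eq]⟩
  -- For odd `p` the factor `p ^ t - 1` of `p ^ (2 * t) - 1` is even.
  have hdvd : 2 * (p ^ t + 1) ∣ Fintype.card K - 1 := by
    have h1 : 2 * (p ^ t + 1) ∣ (p ^ t - 1) * (p ^ t + 1) :=
      mul_dvd_mul_right (Nat.Odd.sub_odd hodd.pow odd_one).two_dvd _
    have h2 : (p ^ t - 1) * (p ^ t + 1) = p ^ (2 * t) - 1 := by
      rw [mul_comm, ← Nat.sq_sub_sq, ← pow_mul, mul_comm t, one_pow]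
    rw [hK, show 2 * k * t = 2 * t * k by ring, pow_mul]
    exact (h2 ▸ h1).trans (Nat.sub_one_dvd_pow_sub_one _ _)
  obtain ⟨ω, hω⟩ := exists_pow_eq_neg_one_of_two_mul_dvd hdvd
  refine ⟨ω, ?_, map_mul_eq_neg_of_pow_eq_neg_one hp hK ht hF hquad hω⟩
  rintro rfl
  simp at hω

theorem exists_diffCount_eq {p k t : ℕ} (hp : p.Prime) {K : Type*} [Field K]
    [Fintype K] [DecidableEq K] (hK : Fintype.card K = p ^ (2 * k * t)) (ht : 0 < t) {F : K → K}
    (hF : IsPowerLikeQuadratic (p ^ t + 1) F) (hquad : algebraicDegree p F ≤ 2) :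
    (∀ g ∈ nonzeroImage F, -g ∈ nonzeroImage F) ∧ ∀ g : K, g ≠ 0 →
      ((p : ℤ) ^ t + 1) ^ 2 * diffCount (nonzeroImage F) g =
        if g ∈ nonzeroImage F then ((p : ℤ) ^ t) ^ (2 * k) - 3 * (p : ℤ) ^ t - 2
            - (-1) ^ k * ((p : ℤ) ^ t) ^ (k + 2) + (-1) ^ k * ((p : ℤ) ^ t) ^ (k + 1)
        else ((p : ℤ) ^ t) ^ (2 * k) - (-1) ^ k * ((p : ℤ) ^ t) ^ k
            + (-1) ^ k * ((p : ℤ) ^ t) ^ (k + 1) - (p : ℤ) ^ t := by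
  obtain ⟨ω, hω, hneg⟩ := exists_mul_eq_neg hp hK ht hF hquad
  have hD : ∀ g ∈ nonzeroImage F, -g ∈ nonzeroImage F := by
    intro g hg
    obtain ⟨x, hx, rfl⟩ := hF.mem_nonzeroImage.1 hg
    exact hF.mem_nonzeroImage.2 ⟨ω * x, mul_ne_zero hω hx, hneg x⟩
  refine ⟨hD, fun g hg => ?_⟩
  obtain ⟨ψ, hψ⟩ : ∃ ψ : AddChar K ℂ, ψ.IsPrimitive := by
    obtain ⟨ψ, hψ⟩ := AddChar.exists_apply_ne_zero.2 hg
    exact ⟨ψ, AddChar.IsPrimitive.of_ne_one fun h => hψ (by rw [h, AddChar.one_apply])⟩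
  have h := hF.card_sub_eq_of_weilSum (Q := -(p : ℤ) ^ t) (k := k)
    (by have := pow_pos hp.pos t; simp; exact_mod_cast this) (by push_cast; ring)
    (by rw [hK]; push_cast; rw [pow_mul (-(p : ℤ) ^ t), neg_sq]; ring)
    hω hneg hψ (hF.weilSum_eq_neg_pow hp ht hK hω hneg ψ) hg
  have h1 := hF.card_sub_eq hg
  have h2 : (-g ∈ nonzeroImage F) ↔ g ∈ nonzeroImage F :=
    ⟨fun h => by simpa using hD _ h, hD g⟩
  simp only [h2] at h1
  zify at h1
  rw [h1] at h
  have hpow : (-(p : ℤ) ^ t) ^ (2 * k) = ((p : ℤ) ^ t) ^ (2 * k) := by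
    rw [pow_mul, neg_sq, ← pow_mul]
  rw [hpow] at h
  split_ifs at h ⊢ with hg'
  · push_cast at h
    rw [neg_pow _ k, neg_pow _ (k + 1)] at h
    linear_combination h
  · push_cast at h
    rw [neg_pow _ k, neg_pow _ (k + 1)] at h
    linear_combination h

theorem theorem3 (p n d t : ℕ) (hp : p.Prime) {K : Type*} [Field K] [Fintype K] [DecidableEq K]
    (hK : Fintype.card K = p ^ n) (hd : 0 < d)
    (hgcd : Nat.gcd d (p ^ n - 1) = p ^ t + 1)
    (F G : K → K) (hFG : ∀ x, F x = G (x ^ d)) (hF0 : F 0 = 0)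
    (hquad : IsQuadratic p F)
    (hG : Set.InjOn G (Set.range fun x : K => x ^ d)) :
    (t = 0 → p ≠ 2 →
      (p ^ n % 4 = 3 →
        IsDifferenceSet (nonzeroImage F) (p ^ n) ((p ^ n - 1) / 2) ((p ^ n - 3) / 4)) ∧
      (p ^ n % 4 = 1 →
        IsPartialDifferenceSet (nonzeroImage F) (p ^ n) ((p ^ n - 1) / 2)
          ((p ^ n - 5) / 4) ((p ^ n - 1) / 4))) ∧
    (0 < t → ∀ k : ℕ, n = 2 * k * t →
      ∃ l m : ℕ,
        (l : ℚ) = ((p : ℚ) ^ n - 3 * (p : ℚ) ^ t - 2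
            - (-1 : ℚ) ^ k * (p : ℚ) ^ (n / 2 + 2 * t)
            + (-1 : ℚ) ^ k * (p : ℚ) ^ (n / 2 + t)) / ((p : ℚ) ^ t + 1) ^ 2 ∧
        (m : ℚ) = ((p : ℚ) ^ n - (-1 : ℚ) ^ k * (p : ℚ) ^ (n / 2)
            + (-1 : ℚ) ^ k * (p : ℚ) ^ (n / 2 + t) - (p : ℚ) ^ t) / ((p : ℚ) ^ t + 1) ^ 2 ∧
        IsRegularPartialDifferenceSet (nonzeroImage F) (p ^ n) ((p ^ n - 1) / (p ^ t + 1)) l m ∧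
        (cayleyGraph (nonzeroImage F)).IsSRGWith (p ^ n) ((p ^ n - 1) / (p ^ t + 1)) l m ∧
        (Even k → IsNegativeLatinSquareType (cayleyGraph (nonzeroImage F)))) := by
  refine ⟨?_, ?_⟩
  · rintro rfl hp2
    have hF : IsPowerLikeQuadratic 2 F :=
      isPowerLikeQuadratic_of_isQuadratic hp hK hd (by simpa using hgcd) one_lt_two
        hFG hF0 hquad hG
    have := charP_of_card_eq_prime_pow' hp hK
    refine hF.isDifferenceSet_or_isPartialDifferenceSet ?_ hK
    exact Ring.two_ne_zero (ringChar.eq K p ▸ hp2)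
  · rintro ht k rfl
    have hP : 1 < p ^ t := Nat.one_lt_pow ht.ne' hp.one_lt
    have hF : IsPowerLikeQuadratic (p ^ t + 1) F :=
      isPowerLikeQuadratic_of_isQuadratic hp hK hd hgcd (by omega) hFG hF0 hquad hG
    obtain ⟨hneg, hcount⟩ := exists_diffCount_eq hp hK ht hF hquad.le
    have hcard := hF.card_nonzeroImage
    rw [hK] at hcard
    have hq : 1 < p ^ (2 * k * t) := hK ▸ Fintype.one_lt_card
    have hDpos : 0 < (nonzeroImage F).card := by
      by_contra h
      rw [Nat.eq_zero_of_not_pos h] at hcard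
      omega
    -- Taking `l` and `m` to be the counts at one element inside and one outside `D` makes them
    -- natural numbers without any divisibility argument.
    obtain ⟨g₁, hg₁⟩ := Finset.card_pos.1 hDpos
    obtain ⟨g₂, hg₂0, hg₂⟩ : ∃ g ∈ Finset.univ.erase (0 : K), g ∉ nonzeroImage F := by
      apply Finset.exists_mem_notMem_of_card_lt_card
      rw [Finset.card_erase_of_mem (Finset.mem_univ _), Finset.card_univ, hK, ← hcard]
      nlinarith
    rw [Finset.mem_erase, and_iff_left (Finset.mem_univ _)] at hg₂0
    have hg₁0 : g₁ ≠ 0 := fun h => by simp [h, nonzeroImage] at hg₁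
    have hl := hcount g₁ hg₁0
    have hm := hcount g₂ hg₂0
    rw [if_pos hg₁] at hl
    rw [if_neg hg₂] at hm
    have hP0 : ((p : ℤ) ^ t + 1) ^ 2 ≠ 0 := by positivity
    have hpds : IsRegularPartialDifferenceSet (nonzeroImage F) (p ^ (2 * k * t))
        ((p ^ (2 * k * t) - 1) / (p ^ t + 1)) (diffCount (nonzeroImage F) g₁)
        (diffCount (nonzeroImage F) g₂) := by
      refine ⟨⟨hK, ?_, by simp [nonzeroImage], fun g hg => ?_, fun g hg hg0 => ?_⟩, hneg⟩
      · rw [← hcard, Nat.mul_div_cancel _ (Nat.succ_pos _)]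
      · have h := hcount g fun h => by simp [h, nonzeroImage] at hg
        rw [if_pos hg, ← hl] at h
        exact_mod_cast mul_left_cancel₀ hP0 h
      · have h := hcount g hg0
        rw [if_neg hg, ← hm] at h
        exact_mod_cast mul_left_cancel₀ hP0 h
    have hn2 : 2 * k * t / 2 = k * t := by rw [mul_assoc, Nat.mul_div_cancel_left _ two_pos]
    have hQ0 : ((p : ℚ) ^ t + 1) ^ 2 ≠ 0 := by positivity
    refine ⟨_, _, ?_, ?_, hpds, hpds.isSRGWith, fun hk => ?_⟩
    · rw [eq_div_iff hQ0, mul_comm, hn2]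
      have h := congrArg (Int.cast : ℤ → ℚ) hl
      push_cast at h
      rw [h]
      ring
    · rw [eq_div_iff hQ0, mul_comm, hn2]
      have h := congrArg (Int.cast : ℤ → ℚ) hm
      push_cast at h
      rw [h]
      ring
    -- The Latin square parameters are `s = p ^ (t * k)` and `r = (s - 1) / (p ^ t + 1)`, integral
    -- because `k` is even.
    · obtain ⟨r, hr⟩ : p ^ t + 1 ∣ (p ^ t) ^ k - 1 := by
        obtain ⟨c, rfl⟩ := hk
        rw [← two_mul, pow_mul]
        refine dvd_trans ?_ (Nat.sub_one_dvd_pow_sub_one _ c)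
        exact ⟨p ^ t - 1, by rw [← Nat.sq_sub_sq, one_pow]⟩
      have hr' : (p ^ t) ^ k = (p ^ t + 1) * r + 1 := by
        have := Nat.one_le_pow k (p ^ t) (by omega)
        omega
      have hrz : ((p : ℤ) ^ t) ^ k = ((p : ℤ) ^ t + 1) * r + 1 := by exact_mod_cast hr'
      have hsq : ((p ^ t) ^ k) ^ 2 = p ^ (2 * k * t) := by ring
      have hdeg : r * ((p ^ t) ^ k + 1) = (p ^ (2 * k * t) - 1) / (p ^ t + 1) := by
        rw [← hsq, show ((p ^ t) ^ k) ^ 2 - 1 = ((p ^ t) ^ k + 1) * ((p ^ t) ^ k - 1) by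
          rw [← Nat.sq_sub_sq, one_pow], hr, mul_left_comm, Nat.mul_div_cancel_left _ (by omega),
          mul_comm]
      rw [hk.neg_one_pow, pow_mul', pow_succ _ k, pow_add _ k 2, hrz] at hl
      rw [hk.neg_one_pow, pow_mul', pow_succ _ k, hrz] at hm
      refine ⟨(p ^ t) ^ k, r, _, _, ?_, ?_, hsq ▸ hdeg ▸ hpds.isSRGWith⟩
      · apply mul_left_cancel₀ hP0
        rw [hl]
        push_cast
        rw [hrz]
        ring
      · zify
        apply mul_left_cancel₀ hP0
        rw [hm]
        ring
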